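/- Let $\alpha > 1$ be a real number and let $\epsilon_1, \epsilon_2, \dots$ be i.i.d. random variables on a probability space with $\mathbb{P}(\epsilon_k = 1) = \mathbb{P}(\epsilon_k = -1) = 1/2$. Put $a_n = \lfloor (\log n)^\alpha \rfloor$ for $n \ge 1$, where $\log$ is the natural logarithm, and let \[ X_n = \sum_{k=1}^n \epsilon_k a_k \qquad (n \ge 0) \] be the Rademacher random walk with step sizes $(a_n)_{n \ge 1}$. Then $(X_n)_{n\ge 0}$ is transient, i.e. it is not weakly recurrent: \[ \mathbb{P}\bigl(\text{there is } C < \infty \text{ such that } |X_n| \le C \text{ for infinitely many } n\bigr) \neq 1 . \] -/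

import Mathlib

open MeasureTheory ProbabilityTheory Filter

/-- The family `ε` consists of i.i.d. Rademacher random variables under `μ`: they are measurable
and mutually independent, and each takes the values `1` and `-1` with probability `1/2` each. -/
structure IsRademacherFamily {ι Ω : Type*} [MeasurableSpace Ω] (μ : Measure Ω)
    (ε : ι → Ω → ℝ) : Prop where
  measurable : ∀ k, Measurable (ε k)
  indep : iIndepFun ε μ
  prob_one : ∀ k, μ {ω | ε k ω = 1} = 1 / 2
  prob_neg_one : ∀ k, μ {ω | ε k ω = -1} = 1 / 2

/-- The Rademacher walk `X_n = ε_1 a_1 + ⋯ + ε_n a_n`. The step sizes are `a 1, a 2, …`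
(the value `a 0` is not used), and the signs are listed from index zero, so that `ε k` is the
sign of the step of size `a (k + 1)`. -/
def rademacherWalk {Ω : Type*} (ε : ℕ → Ω → ℝ) (a : ℕ → ℝ) (n : ℕ) (ω : Ω) : ℝ :=
  ∑ k ∈ Finset.range n, ε k ω * a (k + 1)

/-- A walk is weakly recurrent if the event `{∃ C, |X_n| ≤ C infinitely often}` has
probability one. -/
def IsWeaklyRecurrent {Ω : Type*} [MeasurableSpace Ω] (μ : Measure Ω) (X : ℕ → Ω → ℝ) : Prop :=
  μ {ω | ∃ C : ℝ, ∃ᶠ n in atTop, |X n ω| ≤ C} = 1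

/-- A walk is transient if it is not weakly recurrent. -/
def IsTransient {Ω : Type*} [MeasurableSpace Ω] (μ : Measure Ω) (X : ℕ → Ω → ℝ) : Prop :=
  ¬ IsWeaklyRecurrent μ X

/-! Let `t_m` be the number of steps smaller than `m`. From time `t_m` to time `t_(m+1)` all steps
equal `m`; the length `D_m` of this block is of order `e(m) m^(β-1)`, where `e(m) = exp (m^β)` and
`β = 1/α < 1`. Once the walk enters `[-C, C]` during the block, it makes only `O(√D_m)` net steps
until the end of the block with probability at least `1/2`, and then sits at one of `O(C √D_m)`
integer points. By Fourier inversion each of these has probability at most the mean over a period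
of the product of the `|cos (a_k t)|`. Near `0` and `π` the Gaussian bound on the cosine makes the
mean `O(1 / (m √e(m)))`. Elsewhere one of `sin (i t)`, `sin ((i+1) t)` is at least of order `1/m`,
because `sin t` is the sine of a difference, and the many steps `i = m - 1` and `i = m` make the
product tiny. So block `m` meets `[-C, C]` with probability `O(m^(-1-(1-β)/2))`, which is summable,
and the Borel–Cantelli lemma gives `|X_n| → ∞` almost surely.
-/

section Fourier

open Real

lemma integral_cexp_int_mul_I (k : ℤ) :
    ∫ t in -π..π, Complex.exp (t * k * Complex.I) = if k = 0 then 2 * (π : ℂ) else 0 := by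
  split_ifs with hk
  · simp [hk, two_mul]
  · have hc : (k : ℂ) * Complex.I ≠ 0 := by simp [hk]
    have hper : Complex.exp (k * Complex.I * π) = Complex.exp (k * Complex.I * ((-π : ℝ) : ℂ)) :=
      Complex.exp_eq_exp_iff_exists_int.2 ⟨k, by push_cast; ring⟩
    simp_rw [mul_assoc, mul_comm _ ((k : ℂ) * Complex.I)]
    rw [integral_exp_mul_complex hc, hper, sub_self, zero_div]

lemma integral_cexp_mul_sub_eq (ν : Measure ℝ) (t y : ℝ) :
    ∫ x, Complex.exp (t * (x - y) * Complex.I) ∂ν =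
      charFun ν t * Complex.exp ((-(t * y) : ℝ) * Complex.I) := by
  rw [charFun_apply_real, ← integral_mul_const]
  refine integral_congr_ae (.of_forall fun x => ?_)
  simp only [← Complex.exp_add]
  push_cast
  ring_nf

variable {ν : Measure ℝ} [IsFiniteMeasure ν]

lemma intervalIntegral_integral_cexp_eq
    (hν : ∀ᵐ x : ℝ ∂ν, ∃ z : ℤ, x = z) (y : ℤ) :
    ∫ t in -π..π, ∫ x, Complex.exp (t * (x - (y : ℝ)) * Complex.I) ∂ν =
      (2 * π * ν.real {(y : ℝ)} : ℝ) := by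
  have : IsFiniteMeasure (volume.restrict (Set.uIoc (-π) π)) :=
    isFiniteMeasure_restrict_Ioc _ _
  have hint : Integrable
      (Function.uncurry fun t x : ℝ => Complex.exp (t * (x - (y : ℝ)) * Complex.I))
      ((volume.restrict (Set.uIoc (-π) π)).prod ν) := by
    refine (integrable_const (1 : ℝ)).mono' ?_ (.of_forall fun p => ?_)
    · exact Continuous.aestronglyMeasurable (by unfold Function.uncurry; fun_prop)
    · rw [Function.uncurry, ← Complex.ofReal_sub, ← Complex.ofReal_mul,
        Complex.norm_exp_ofReal_mul_I]
  have hinner : (fun x : ℝ => ∫ t in -π..π, Complex.exp (t * (x - (y : ℝ)) * Complex.I)) =ᵐ[ν]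
      Set.indicator {(y : ℝ)} fun _ => 2 * (π : ℂ) := by
    filter_upwards [hν] with x ⟨z, hz⟩
    have hzy := integral_cexp_int_mul_I (z - y)
    push_cast at hzy
    simp [hz, hzy, Set.indicator_apply, sub_eq_zero]
  rw [intervalIntegral_integral_swap hint, integral_congr_ae hinner,
    integral_indicator_const _ (measurableSet_singleton _)]
  simp [mul_comm]

lemma measureReal_singleton_le_integral_norm_charFun
    (hν : ∀ᵐ x : ℝ ∂ν, ∃ z : ℤ, x = z) (y : ℤ) :
    ν.real {(y : ℝ)} ≤ (2 * π)⁻¹ * ∫ t in -π..π, ‖charFun ν t‖ := by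
  rw [le_inv_mul_iff₀ (by positivity)]
  calc 2 * π * ν.real {(y : ℝ)}
      = ‖((2 * π * ν.real {(y : ℝ)} : ℝ) : ℂ)‖ := by
        rw [Complex.norm_of_nonneg (by positivity)]
    _ = ‖∫ t in -π..π, ∫ x, Complex.exp (t * (x - (y : ℝ)) * Complex.I) ∂ν‖ := by
        rw [intervalIntegral_integral_cexp_eq hν]
    _ ≤ ∫ t in -π..π, ‖∫ x, Complex.exp (t * (x - (y : ℝ)) * Complex.I) ∂ν‖ :=
        intervalIntegral.norm_integral_le_integral_norm (by linarith [pi_pos])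
    _ = ∫ t in -π..π, ‖charFun ν t‖ := by
        simp only [integral_cexp_mul_sub_eq, norm_mul, Complex.norm_exp_ofReal_mul_I, mul_one]

end Fourier

section MaximalInequality

open scoped ENNReal

variable {Ω : Type*} [mΩ : MeasurableSpace Ω] {μ : Measure Ω}

-- Split according to the first `E i` that occurs: this event lies in the past `𝓕 i`, so it is
-- independent of `G i`.
lemma mul_measure_iUnion_le_measure_iUnion_inter {𝓕 𝓖 : ℕ → MeasurableSpace Ω}
    (h𝓕 : Monotone 𝓕) (h𝓕Ω : ∀ i, 𝓕 i ≤ mΩ) (h𝓖Ω : ∀ i, 𝓖 i ≤ mΩ)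
    (hindep : ∀ i, Indep (𝓕 i) (𝓖 i) μ) {E G : ℕ → Set Ω}
    (hE : ∀ i, MeasurableSet[𝓕 i] (E i)) (hG : ∀ i, MeasurableSet[𝓖 i] (G i))
    {q : ℝ≥0∞} (hq : ∀ i, q ≤ μ (G i)) :
    q * μ (⋃ i, E i) ≤ μ (⋃ i, E i ∩ G i) := by
  have hfirst (i : ℕ) : MeasurableSet[𝓕 i] (disjointed E i) := by
    rw [disjointed_eq_inter_compl]
    exact (hE i).inter <| .biInter (Set.to_countable _) fun j hj =>
      (h𝓕 (Nat.le_of_lt hj) _ (hE j)).compl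
  have hdisj := disjoint_disjointed E
  calc q * μ (⋃ i, E i) = ∑' i, q * μ (disjointed E i) := by
        rw [← iUnion_disjointed, measure_iUnion hdisj fun i => h𝓕Ω i _ (hfirst i),
          ENNReal.tsum_mul_left]
    _ ≤ ∑' i, μ (disjointed E i ∩ G i) := by
        refine ENNReal.tsum_le_tsum fun i => ?_
        rw [(Indep_iff _ _ μ).1 (hindep i) _ _ (hfirst i) (hG i), mul_comm]
        gcongr
        exact hq i
    _ = μ (⋃ i, disjointed E i ∩ G i) :=
        (measure_iUnion
          (fun i j hij => (hdisj hij).mono Set.inter_subset_left Set.inter_subset_left)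
          fun i => (h𝓕Ω i _ (hfirst i)).inter (h𝓖Ω i _ (hG i))).symm
    _ ≤ μ (⋃ i, E i ∩ G i) := by
        gcongr
        exact disjointed_subset E _

end MaximalInequality

/-- The bound `(2π)⁻¹ ∫_{-π}^{π} |φ|` on the point masses of the walk with integer step sizes `a`
at time `n`; here `φ` is the characteristic function of the walk, a product of cosines. -/
noncomputable def concentrationBound (a : ℕ → ℕ) (n : ℕ) : ℝ :=
  (2 * Real.pi)⁻¹ * ∫ t in -Real.pi..Real.pi, ∏ k ∈ Finset.range n, |Real.cos (a (k + 1) * t)|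

lemma concentrationBound_nonneg (a : ℕ → ℕ) (n : ℕ) : 0 ≤ concentrationBound a n :=
  mul_nonneg (by positivity)
    (intervalIntegral.integral_nonneg (neg_le_self Real.pi_pos.le)
      fun _ _ => Finset.prod_nonneg fun _ _ => abs_nonneg _)

/-- The σ-algebra generated by the variables `ε k` with `k ∈ S`. -/
@[reducible] def generatedBy {ι Ω : Type*} (ε : ι → Ω → ℝ) (S : Set ι) : MeasurableSpace Ω :=
  ⨆ k ∈ S, MeasurableSpace.comap (ε k) inferInstance

lemma generatedBy_mono {ι Ω : Type*} (ε : ι → Ω → ℝ) : Monotone (generatedBy ε) :=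
  fun _ _ hST => biSup_mono hST

lemma measurable_generatedBy_sum_mul {ι Ω : Type*} (ε : ι → Ω → ℝ) {S : Set ι} {s : Finset ι}
    (hs : ∀ k ∈ s, k ∈ S) (w : ι → ℝ) :
    Measurable[generatedBy ε S] fun ω => ∑ k ∈ s, ε k ω * w k :=
  Finset.measurable_fun_sum _ fun k hk =>
    ((comap_measurable (ε k)).mono
      (le_biSup (fun k => MeasurableSpace.comap (ε k) inferInstance) (hs k hk))
      le_rfl).mul_const _

lemma rademacherWalk_eq_add_mul_sum {Ω : Type*} (ε : ℕ → Ω → ℝ) {a : ℕ → ℝ} {n M : ℕ}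
    (hnM : n ≤ M) {x : ℝ} (ha : ∀ k ∈ Finset.Ico n M, a (k + 1) = x) (ω : Ω) :
    rademacherWalk ε a M ω = rademacherWalk ε a n ω + x * ∑ k ∈ Finset.Ico n M, ε k ω := by
  rw [rademacherWalk, rademacherWalk, ← Finset.sum_range_add_sum_Ico _ hnM, Finset.mul_sum]
  congr 1
  exact Finset.sum_congr rfl fun k hk => by rw [ha k hk, mul_comm]

lemma eq_iff_mem_Ico_of_galoisConnection {l u : ℕ → ℕ} (gc : GaloisConnection l u) {i k : ℕ} :
    u k = i ↔ k ∈ Finset.Ico (l i) (l (i + 1)) := by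
  rw [Finset.mem_Ico, gc i k, gc.lt_iff_lt, Nat.lt_succ_iff, and_comm, le_antisymm_iff]

lemma measureReal_exists_eq_add_mul_le {Ω : Type*} [MeasurableSpace Ω] {μ : Measure Ω}
    {X : Ω → ℝ} (C R m : ℕ) {p : ℝ}
    (hp : ∀ y : ℤ, μ.real {ω | X ω = y} ≤ p) :
    μ.real {ω | ∃ q ∈ Finset.Icc (-C : ℤ) C ×ˢ Finset.Icc (-R : ℤ) R,
      X ω = ((q.1 + m * q.2 : ℤ) : ℝ)} ≤ (2 * C + 1) * (2 * R + 1) * p := by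
  have hunion : {ω | ∃ q ∈ Finset.Icc (-C : ℤ) C ×ˢ Finset.Icc (-R : ℤ) R,
      X ω = ((q.1 + m * q.2 : ℤ) : ℝ)} = ⋃ q ∈ Finset.Icc (-C : ℤ) C ×ˢ Finset.Icc (-R : ℤ) R,
      {ω | X ω = ((q.1 + m * q.2 : ℤ) : ℝ)} := by
    ext ω
    simp only [Set.mem_ofPred_eq, Set.mem_iUnion, exists_prop]
  rw [hunion]
  refine (measureReal_biUnion_finset_le _ _).trans ?_
  refine (Finset.sum_le_card_nsmul _ _ p fun q _ => hp _).trans_eq ?_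
  rw [Finset.card_product, Int.card_Icc, Int.card_Icc, nsmul_eq_mul,
    show ((C : ℤ) + 1 - -C).toNat = 2 * C + 1 by omega,
    show ((R : ℤ) + 1 - -R).toNat = 2 * R + 1 by omega]
  push_cast
  rfl

namespace IsRademacherFamily

variable {ι Ω : Type*} [mΩ : MeasurableSpace Ω] {μ : Measure Ω}

section Signs

variable {ε : ι → Ω → ℝ}

lemma generatedBy_le (hε : IsRademacherFamily μ ε) (S : Set ι) : generatedBy ε S ≤ mΩ :=
  iSup₂_le fun k _ => (hε.measurable k).comap_le

lemma indep_generatedBy (hε : IsRademacherFamily μ ε) {S T : Set ι} (hST : Disjoint S T) :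
    Indep (generatedBy ε S) (generatedBy ε T) μ :=
  indep_iSup_of_disjoint (fun k => (hε.measurable k).comap_le) hε.indep hST

lemma measurableSet_eq (hε : IsRademacherFamily μ ε) (k : ι) (x : ℝ) :
    MeasurableSet {ω | ε k ω = x} :=
  hε.measurable k (measurableSet_singleton x)

variable [IsProbabilityMeasure μ]

lemma ae_eq_one_or_eq_neg_one (hε : IsRademacherFamily μ ε) (k : ι) :
    ∀ᵐ ω ∂μ, ε k ω = 1 ∨ ε k ω = -1 := by
  have hdisj : Disjoint {ω | ε k ω = 1} {ω | ε k ω = -1} :=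
    Set.disjoint_left.2 fun ω (h : ε k ω = 1) (h' : ε k ω = -1) => by linarith
  have hunion : μ ({ω | ε k ω = 1} ∪ {ω | ε k ω = -1}) = 1 := by
    rw [measure_union hdisj (hε.measurableSet_eq k _), hε.prob_one, hε.prob_neg_one,
      ENNReal.add_halves]
  exact (prob_compl_eq_zero_iff ((hε.measurableSet_eq k _).union (hε.measurableSet_eq k _))).2
    hunion

lemma ae_exists_int_sum_mul_eq (hε : IsRademacherFamily μ ε) (s : Finset ι) (w : ι → ℤ) :
    ∀ᵐ ω ∂μ, ∃ z : ℤ, ∑ k ∈ s, ε k ω * w k = z := by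
  have hall : ∀ᵐ ω ∂μ, ∀ k ∈ s, ε k ω = 1 ∨ ε k ω = -1 :=
    (ae_ball_iff s.countable_toSet).2 fun k _ => hε.ae_eq_one_or_eq_neg_one k
  filter_upwards [hall] with ω hω
  have hsign : ∀ k ∈ s, ε k ω * w k ∈ (Int.castAddHom ℝ).range := by
    rintro k hk
    rcases hω k hk with h | h
    · exact ⟨w k, by simp [h]⟩
    · exact ⟨-w k, by simp [h]⟩
  obtain ⟨z, hz⟩ := sum_mem hsign
  exact ⟨z, hz.symm⟩

lemma integral_comp (hε : IsRademacherFamily μ ε) (k : ι) {E : Type*} [NormedAddCommGroup E]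
    [NormedSpace ℝ E] [CompleteSpace E] (g : ℝ → E) :
    ∫ ω, g (ε k ω) ∂μ = (2 : ℝ)⁻¹ • (g 1 + g (-1)) := by
  have hsplit : (fun ω => g (ε k ω)) =ᵐ[μ] fun ω =>
      {ω | ε k ω = 1}.indicator (fun _ => g 1) ω +
        {ω | ε k ω = -1}.indicator (fun _ => g (-1)) ω := by
    filter_upwards [hε.ae_eq_one_or_eq_neg_one k] with ω hω
    rcases hω with h | h <;> norm_num [Set.indicator_apply, h]
  have h1 := hε.measurableSet_eq k 1
  have h2 := hε.measurableSet_eq k (-1)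
  rw [integral_congr_ae hsplit, integral_add ((integrable_const _).indicator h1)
    ((integrable_const _).indicator h2), integral_indicator_const _ h1,
    integral_indicator_const _ h2]
  simp [Measure.real, hε.prob_one, hε.prob_neg_one]

lemma charFun_map_mul_const (hε : IsRademacherFamily μ ε) (k : ι) (c t : ℝ) :
    charFun (μ.map fun ω => ε k ω * c) t = (Real.cos (c * t) : ℂ) := by
  have := hε.measurable k
  rw [charFun_apply_real, integral_map (by fun_prop) (by fun_prop),
    hε.integral_comp k fun x => Complex.exp (t * ((x * c : ℝ) : ℂ) * Complex.I),
    Complex.ofReal_cos, Complex.cos, Complex.real_smul]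
  push_cast
  ring_nf

lemma memLp_two (hε : IsRademacherFamily μ ε) (k : ι) : MemLp (ε k) 2 μ := by
  refine .of_bound (hε.measurable k).aestronglyMeasurable 1 ?_
  filter_upwards [hε.ae_eq_one_or_eq_neg_one k] with ω hω
  rcases hω with h | h <;> simp [h]

lemma integral_eq_zero (hε : IsRademacherFamily μ ε) (k : ι) : ∫ ω, ε k ω ∂μ = 0 := by
  simpa using hε.integral_comp k fun x : ℝ => x

lemma variance_eq_one (hε : IsRademacherFamily μ ε) (k : ι) : variance (ε k) μ = 1 := by
  rw [variance_of_integral_eq_zero (hε.measurable k).aemeasurable (hε.integral_eq_zero k)]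
  have := hε.integral_comp k fun x : ℝ => x ^ 2
  norm_num at this ⊢
  exact this

lemma measureReal_le_abs_sum_le (hε : IsRademacherFamily μ ε) (s : Finset ι) {x : ℝ} (hx : 0 < x) :
    μ.real {ω | x ≤ |∑ k ∈ s, ε k ω|} ≤ s.card / x ^ 2 := by
  have hmean : ∫ ω, (∑ k ∈ s, ε k) ω ∂μ = 0 := by
    simp only [Finset.sum_apply]
    rw [integral_finsetSum _ fun k _ => (hε.memLp_two k).integrable one_le_two]
    simp [hε.integral_eq_zero]
  have hvar : variance (∑ k ∈ s, ε k) μ = s.card := by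
    rw [IndepFun.variance_sum (fun k _ => hε.memLp_two k)
      fun i _ j _ hij => hε.indep.indepFun hij]
    simp [hε.variance_eq_one]
  have hcheb := meas_ge_le_variance_div_sq (memLp_finsetSum' s fun k _ => hε.memLp_two k) hx
  rw [hmean, hvar] at hcheb
  simp only [Finset.sum_apply, sub_zero] at hcheb
  exact ENNReal.toReal_le_of_le_ofReal (by positivity) hcheb

lemma half_le_measure_abs_sum_lt (hε : IsRademacherFamily μ ε) (s : Finset ι) {x : ℝ} (hx : 0 < x)
    (hs : 2 * s.card ≤ x ^ 2) : 2⁻¹ ≤ μ {ω | |∑ k ∈ s, ε k ω| < x} := by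
  have hmeas := hε.measurable
  have hset : MeasurableSet {ω | |∑ k ∈ s, ε k ω| < x} :=
    measurableSet_lt (by fun_prop) measurable_const
  have hcompl : μ.real {ω | |∑ k ∈ s, ε k ω| < x}ᶜ ≤ 2⁻¹ := by
    simp only [Set.compl_ofPred, not_lt]
    refine (hε.measureReal_le_abs_sum_le s hx).trans ?_
    rw [div_le_iff₀ (by positivity)]
    linarith
  rw [probReal_compl_eq_one_sub hset] at hcompl
  rw [← ofReal_measureReal, ← ENNReal.ofReal_ofNat 2, ← ENNReal.ofReal_inv_of_pos two_pos]
  exact ENNReal.ofReal_le_ofReal (by linarith)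

end Signs

section Walk

variable {ε : ℕ → Ω → ℝ} [IsProbabilityMeasure μ]

lemma norm_charFun_map_rademacherWalk (hε : IsRademacherFamily μ ε) (a : ℕ → ℝ) (n : ℕ) (t : ℝ) :
    ‖charFun (μ.map (rademacherWalk ε a n)) t‖ =
      ∏ k ∈ Finset.range n, |Real.cos (a (k + 1) * t)| := by
  have hmeas := hε.measurable
  have hindep : iIndepFun (fun k ω => ε k ω * a (k + 1)) μ :=
    hε.indep.comp (fun k x => x * a (k + 1)) fun k => by fun_prop
  unfold rademacherWalk
  rw [iIndepFun.charFun_map_fun_finsetSum_eq_prod (X := fun k ω => ε k ω * a (k + 1))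
    (fun k _ => by fun_prop)
    (hindep.precomp (g := ((↑) : Finset.range n → ℕ)) Subtype.val_injective),
    Finset.prod_apply, norm_prod]
  simp only [hε.charFun_map_mul_const, Complex.norm_real, Real.norm_eq_abs]

lemma measureReal_rademacherWalk_eq_le (hε : IsRademacherFamily μ ε) (a : ℕ → ℕ) (n : ℕ) (y : ℤ) :
    μ.real {ω | rademacherWalk ε (fun k => (a k : ℝ)) n ω = y} ≤ concentrationBound a n := by
  have hmeas : Measurable (rademacherWalk ε (fun k => (a k : ℝ)) n) :=
    Finset.measurable_fun_sum _ fun k _ => (hε.measurable k).mul_const _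
  have hint : ∀ᵐ x : ℝ ∂μ.map (rademacherWalk ε (fun k => (a k : ℝ)) n), ∃ z : ℤ, x = z := by
    have hrange : MeasurableSet {x : ℝ | ∃ z : ℤ, x = z} := by
      simpa only [Set.range, eq_comm] using
        (Set.countable_range ((↑) : ℤ → ℝ)).measurableSet
    rw [ae_map_iff hmeas.aemeasurable hrange]
    exact hε.ae_exists_int_sum_mul_eq _ fun k => (a (k + 1) : ℤ)
  have : IsProbabilityMeasure (μ.map (rademacherWalk ε (fun k => (a k : ℝ)) n)) :=
    Measure.isProbabilityMeasure_map hmeas.aemeasurable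
  have hfourier := measureReal_singleton_le_integral_norm_charFun hint y
  simp_rw [hε.norm_charFun_map_rademacherWalk] at hfourier
  rwa [map_measureReal_apply hmeas (measurableSet_singleton _)] at hfourier

lemma ae_exists_rademacherWalk_eq_add_mul (hε : IsRademacherFamily μ ε) {a : ℕ → ℕ} {N M m : ℕ}
    (ha : ∀ k ∈ Finset.Ico N M, a (k + 1) = m) (C R : ℕ) :
    ∀ᵐ ω ∂μ, ∀ n ∈ Finset.Icc N M, |rademacherWalk ε (fun k => (a k : ℝ)) n ω| ≤ C →
      |∑ k ∈ Finset.Ico n M, ε k ω| < R + 1 →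
      ∃ q ∈ Finset.Icc (-C : ℤ) C ×ˢ Finset.Icc (-R : ℤ) R,
        rademacherWalk ε (fun k => (a k : ℝ)) M ω = ((q.1 + m * q.2 : ℤ) : ℝ) := by
  have hstart := ae_all_iff.2 fun n =>
    hε.ae_exists_int_sum_mul_eq (Finset.range n) fun k => (a (k + 1) : ℤ)
  have hblock := ae_all_iff.2 fun n => hε.ae_exists_int_sum_mul_eq (Finset.Ico n M) fun _ => 1
  filter_upwards [hstart, hblock] with ω hstart hblock n hn hC hR
  obtain ⟨r, hr⟩ := hstart n
  obtain ⟨s, hs⟩ := hblock n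
  obtain ⟨hNn, hnM⟩ := Finset.mem_Icc.1 hn
  simp only [Int.cast_natCast, Int.cast_one, mul_one] at hr hs
  change rademacherWalk ε (fun k => (a k : ℝ)) n ω = r at hr
  rw [hr] at hC
  rw [hs] at hR
  norm_cast at hC hR
  refine ⟨(r, s), Finset.mem_product.2
    ⟨Finset.mem_Icc.2 (abs_le.1 hC), Finset.mem_Icc.2 (abs_le.1 (Int.lt_add_one_iff.1 hR))⟩, ?_⟩
  have hm : ∀ k ∈ Finset.Ico n M, (a (k + 1) : ℝ) = m := fun k hk => by
    rw [ha k (Finset.Ico_subset_Ico_left hNn hk)]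
  rw [rademacherWalk_eq_add_mul_sum ε hnM hm, hr, hs]
  push_cast
  rfl

lemma half_mul_measure_exists_abs_rademacherWalk_le (hε : IsRademacherFamily μ ε) (a : ℕ → ℝ)
    {N M : ℕ} (C : ℝ) {x : ℝ} (hx : 0 < x) (hMN : 2 * ((M - N : ℕ) : ℝ) ≤ x ^ 2) :
    2⁻¹ * μ {ω | ∃ n ∈ Finset.Icc N M, |rademacherWalk ε a n ω| ≤ C} ≤
      μ {ω | ∃ n ∈ Finset.Icc N M,
        |rademacherWalk ε a n ω| ≤ C ∧ |∑ k ∈ Finset.Ico n M, ε k ω| < x} := by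
  let E (i : ℕ) : Set Ω := {ω | |rademacherWalk ε a (N + i) ω| ≤ C ∧ N + i ≤ M}
  let G (i : ℕ) : Set Ω := {ω | |∑ k ∈ Finset.Ico (N + i) M, ε k ω| < x}
  have hE (i : ℕ) : MeasurableSet[generatedBy ε (Set.Iio (N + i))] (E i) := by
    have hwalk : Measurable[generatedBy ε (Set.Iio (N + i))] (rademacherWalk ε a (N + i)) :=
      measurable_generatedBy_sum_mul ε (fun k hk => Finset.mem_range.1 hk) _
    exact (hwalk (measurableSet_le measurable_id.abs measurable_const)).inter (.const _)
  have hG (i : ℕ) : MeasurableSet[generatedBy ε (Set.Ici (N + i))] (G i) := by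
    have hsum := measurable_generatedBy_sum_mul ε (S := Set.Ici (N + i))
      (s := Finset.Ico (N + i) M) (fun k hk => (Finset.mem_Ico.1 hk).1) 1
    simp only [Pi.one_apply, mul_one] at hsum
    exact hsum (measurableSet_lt measurable_id.abs measurable_const)
  have hhalf (i : ℕ) : 2⁻¹ ≤ μ (G i) := by
    refine hε.half_le_measure_abs_sum_lt _ hx (le_trans ?_ hMN)
    rw [Nat.card_Ico]
    gcongr
    exact Nat.le_add_right N i
  have henter : {ω | ∃ n ∈ Finset.Icc N M, |rademacherWalk ε a n ω| ≤ C} ⊆ ⋃ i, E i := by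
    rintro ω ⟨n, hn, hC⟩
    obtain ⟨i, rfl⟩ := Nat.exists_eq_add_of_le (Finset.mem_Icc.1 hn).1
    exact Set.mem_iUnion.2 ⟨i, hC, (Finset.mem_Icc.1 hn).2⟩
  refine le_trans (by gcongr) ((mul_measure_iUnion_le_measure_iUnion_inter
    (fun i j hij => generatedBy_mono ε (Set.Iio_subset_Iio (Nat.add_le_add_left hij N)))
    (fun i => hε.generatedBy_le _) (fun i => hε.generatedBy_le _)
    (fun i => hε.indep_generatedBy (Set.Iio_disjoint_Ici le_rfl)) hE hG hhalf).trans
    (measure_mono (Set.iUnion_subset fun i ω hω => ?_)))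
  exact ⟨N + i, Finset.mem_Icc.2 ⟨Nat.le_add_right N i, hω.1.2⟩, hω.1.1, hω.2⟩

-- If the walk enters `[-C, C]` during the block, then with probability at least `1 / 2` it makes
-- at most `R` net steps of size `m` from there to the end of the block, where it is then at one of
-- the points `r + m * s` with `|r| ≤ C` and `|s| ≤ R`.
lemma measureReal_exists_abs_rademacherWalk_le_block (hε : IsRademacherFamily μ ε) {a : ℕ → ℕ}
    {N M m R : ℕ} (C : ℕ) {p : ℝ} (hR : 2 * (M - N) ≤ (R + 1) ^ 2)
    (ha : ∀ k ∈ Finset.Ico N M, a (k + 1) = m)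
    (hp : ∀ y : ℤ, μ.real {ω | rademacherWalk ε (fun k => (a k : ℝ)) M ω = y} ≤ p) :
    μ.real {ω | ∃ n ∈ Finset.Icc N M, |rademacherWalk ε (fun k => (a k : ℝ)) n ω| ≤ C} ≤
      2 * ((2 * C + 1) * (2 * R + 1) * p) := by
  set X := rademacherWalk ε (fun k => (a k : ℝ))
  have hend :
      {ω | ∃ n ∈ Finset.Icc N M, |X n ω| ≤ C ∧ |∑ k ∈ Finset.Ico n M, ε k ω| < R + 1} ≤ᵐ[μ]
        {ω | ∃ q ∈ Finset.Icc (-C : ℤ) C ×ˢ Finset.Icc (-R : ℤ) R,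
          X M ω = ((q.1 + m * q.2 : ℤ) : ℝ)} := by
    filter_upwards [hε.ae_exists_rademacherWalk_eq_add_mul ha C R] with ω hω ⟨n, hn, hC, hR⟩
    exact hω n hn hC hR
  have hreal := ENNReal.toReal_mono (measure_ne_top _ _)
    ((hε.half_mul_measure_exists_abs_rademacherWalk_le _ C (x := R + 1) (by positivity)
      (by exact_mod_cast hR)).trans (measure_mono_ae hend))
  rw [ENNReal.toReal_mul, ENNReal.toReal_inv, ENNReal.toReal_ofNat,
    inv_mul_le_iff₀ two_pos] at hreal
  exact hreal.trans (by gcongr; exact measureReal_exists_eq_add_mul_le C R m hp)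

end Walk

section Criterion

variable {ε : ℕ → Ω → ℝ} [IsProbabilityMeasure μ] {a c : ℕ → ℕ}

lemma measureReal_exists_abs_rademacherWalk_le (hε : IsRademacherFamily μ ε)
    (gc : GaloisConnection c fun k => a (k + 1)) (C m : ℕ) :
    μ.real {ω | ∃ n ∈ Finset.Icc (c m) (c (m + 1)),
        |rademacherWalk ε (fun k => (a k : ℝ)) n ω| ≤ C} ≤
      6 * (2 * C + 1) *
        ((√(c (m + 1) - c m : ℕ) + 1) * concentrationBound a (c (m + 1))) := by
  have hstep : ∀ k ∈ Finset.Ico (c m) (c (m + 1)), a (k + 1) = m := fun k hk =>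
    (eq_iff_mem_Ico_of_galoisConnection gc).2 hk
  set D := c (m + 1) - c m
  have hroot : 2 * (Nat.sqrt (2 * D) : ℝ) ≤ 3 * √D := by
    rw [← Real.sqrt_sq (show (0 : ℝ) ≤ 3 by norm_num), ← Real.sqrt_mul (by positivity)]
    refine Real.le_sqrt_of_sq_le ?_
    have hsq : ((Nat.sqrt (2 * D) : ℝ)) ^ 2 ≤ 2 * D := by exact_mod_cast Nat.sqrt_le' (2 * D)
    linarith [D.cast_nonneg (α := ℝ)]
  have hB := concentrationBound_nonneg a (c (m + 1))
  calc _ ≤ 2 * ((2 * C + 1) * (2 * Nat.sqrt (2 * D) + 1) * concentrationBound a (c (m + 1))) :=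
        hε.measureReal_exists_abs_rademacherWalk_le_block C (Nat.lt_succ_sqrt' _).le hstep
          (hε.measureReal_rademacherWalk_eq_le a _)
    _ ≤ 2 * ((2 * C + 1) * (3 * (√D + 1)) * concentrationBound a (c (m + 1))) := by
        gcongr
        linarith
    _ = _ := by ring

theorem ae_tendsto_abs_rademacherWalk (hε : IsRademacherFamily μ ε)
    (gc : GaloisConnection c fun k => a (k + 1))
    (hsum : Summable fun m =>
      (√(c (m + 1) - c m : ℕ) + 1) * concentrationBound a (c (m + 1))) :
    ∀ᵐ ω ∂μ, Tendsto (fun n => |rademacherWalk ε (fun k => (a k : ℝ)) n ω|) atTop atTop := by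
  let E (C m : ℕ) : Set Ω := {ω | ∃ n ∈ Finset.Icc (c m) (c (m + 1)),
    |rademacherWalk ε (fun k => (a k : ℝ)) n ω| ≤ C}
  have hfin (C : ℕ) : ∑' m, μ (E C m) ≠ ⊤ := by
    have hreal : Summable fun m => μ.real (E C m) :=
      .of_nonneg_of_le (fun _ => measureReal_nonneg)
        (hε.measureReal_exists_abs_rademacherWalk_le gc C) (hsum.mul_left _)
    simpa only [Measure.real, ENNReal.ofReal_toReal (measure_ne_top μ _)] using
      hreal.tsum_ofReal_ne_top
  have hstep : Tendsto (fun n => a (n + 1)) atTop atTop :=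
    tendsto_atTop.2 fun m => (eventually_ge_atTop (c m)).mono fun n => (gc m n).1
  filter_upwards [ae_all_iff.2 fun C => ae_eventually_notMem (hfin C)] with ω hω
  refine tendsto_atTop.2 fun x => ?_
  obtain ⟨C, hC⟩ := exists_nat_ge x
  filter_upwards [hstep.eventually (hω C)] with n hn
  have hblock : n ∈ Finset.Icc (c (a (n + 1))) (c (a (n + 1) + 1)) :=
    Finset.Ico_subset_Icc_self ((eq_iff_mem_Ico_of_galoisConnection gc).1 rfl)
  exact hC.trans (not_le.1 fun hle => hn ⟨n, hblock, hle⟩).le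

end Criterion

end IsRademacherFamily

lemma isTransient_of_ae_tendsto_abs {Ω : Type*} [MeasurableSpace Ω] {μ : Measure Ω}
    {X : ℕ → Ω → ℝ} (hX : ∀ᵐ ω ∂μ, Tendsto (fun n => |X n ω|) atTop atTop) :
    IsTransient μ X := by
  have hnull : μ {ω | ∃ C : ℝ, ∃ᶠ n in atTop, |X n ω| ≤ C} = 0 := by
    refine measure_mono_null (fun ω => ?_) (ae_iff.1 hX)
    rintro ⟨C, hC⟩ htop
    exact hC ((htop.eventually_gt_atTop C).mono fun n => not_le.2)
  rw [IsTransient, IsWeaklyRecurrent, hnull]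
  exact zero_ne_one

section ProductsOfCosines

open Real

variable {ι : Type*} {s : Finset ι}

lemma abs_cos_le_exp_neg_sin_sq_div_two (x : ℝ) : |cos x| ≤ exp (-(sin x ^ 2 / 2)) := by
  rw [abs_cos_eq_sqrt_one_sub_sin_sq, sqrt_le_left (exp_pos _).le, ← exp_nat_mul]
  convert one_sub_le_exp_neg (sin x ^ 2) using 2
  push_cast
  ring

lemma prod_abs_cos_le_exp_neg_sum_sin_sq_div_two (s : Finset ι) (g : ι → ℝ) :
    ∏ k ∈ s, |cos (g k)| ≤ exp (-((∑ k ∈ s, sin (g k) ^ 2) / 2)) := by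
  rw [Finset.sum_div, ← Finset.sum_neg_distrib, exp_sum]
  exact Finset.prod_le_prod (fun _ _ => abs_nonneg _) fun k _ =>
    abs_cos_le_exp_neg_sin_sq_div_two (g k)

lemma four_div_pi_sq_mul_sum_sq_le_sum_sin_sq {g : ι → ℝ} (hg : ∀ k ∈ s, |g k| ≤ π / 2) :
    4 / π ^ 2 * ∑ k ∈ s, g k ^ 2 ≤ ∑ k ∈ s, sin (g k) ^ 2 := by
  rw [Finset.mul_sum]
  refine Finset.sum_le_sum fun k hk => ?_
  calc 4 / π ^ 2 * g k ^ 2 = (2 / π * |g k|) ^ 2 := by rw [mul_pow, sq_abs]; ring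
    _ ≤ |sin (g k)| ^ 2 := by gcongr; exact mul_abs_le_abs_sin (hg k hk)
    _ = sin (g k) ^ 2 := sq_abs _

lemma sin_sub_sq_le (x y : ℝ) : sin (x - y) ^ 2 ≤ 2 * (sin x ^ 2 + sin y ^ 2) := by
  rw [sin_sub]
  have hx : (cos x * sin y) ^ 2 ≤ sin y ^ 2 := by
    rw [mul_pow]
    exact mul_le_of_le_one_left (sq_nonneg _) (cos_sq_le_one x)
  have hy : (sin x * cos y) ^ 2 ≤ sin x ^ 2 := by
    rw [mul_pow]
    exact mul_le_of_le_one_right (sq_nonneg _) (cos_sq_le_one y)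
  linarith [sq_nonneg (sin x * cos y + cos x * sin y),
    sub_sq (sin x * cos y) (cos x * sin y), add_sq (sin x * cos y) (cos x * sin y)]

variable {w : ι → ℕ} {m L : ℕ}

lemma mul_sin_sq_div_two_le_sum_sin_sq (hm : L ≤ (s.filter fun k => w k = m).card)
    (hm' : L ≤ (s.filter fun k => w k = m + 1).card) (t : ℝ) :
    L * sin t ^ 2 / 2 ≤ ∑ k ∈ s, sin (w k * t) ^ 2 := by
  classical
  have hlevel (i : ℕ) (hi : L ≤ (s.filter fun k => w k = i).card) :
      L * sin (i * t) ^ 2 ≤ ∑ k ∈ s with w k = i, sin (w k * t) ^ 2 := by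
    rw [Finset.sum_congr rfl fun k hk => by rw [(Finset.mem_filter.1 hk).2], Finset.sum_const,
      nsmul_eq_mul]
    gcongr
  have hdisj : Disjoint (s.filter fun k => w k = m) (s.filter fun k => w k = m + 1) :=
    Finset.disjoint_filter.2 fun k _ h h' => by omega
  have hsub := sin_sub_sq_le ((m + 1 : ℕ) * t) (m * t)
  rw [show ((m + 1 : ℕ) : ℝ) * t - m * t = t by push_cast; ring] at hsub
  calc L * sin t ^ 2 / 2
      ≤ L * sin (m * t) ^ 2 + L * sin ((m + 1 : ℕ) * t) ^ 2 := by
        linarith [mul_le_mul_of_nonneg_left hsub L.cast_nonneg]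
    _ ≤ (∑ k ∈ s with w k = m, sin (w k * t) ^ 2) +
          ∑ k ∈ s with w k = m + 1, sin (w k * t) ^ 2 := add_le_add (hlevel _ hm) (hlevel _ hm')
    _ = ∑ k ∈ (s.filter fun k => w k = m) ∪ (s.filter fun k => w k = m + 1),
          sin (w k * t) ^ 2 := (Finset.sum_union hdisj).symm
    _ ≤ ∑ k ∈ s, sin (w k * t) ^ 2 :=
        Finset.sum_le_sum_of_subset_of_nonneg
          (Finset.union_subset (Finset.filter_subset _ _) (Finset.filter_subset _ _))
          fun _ _ _ => sq_nonneg _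

-- For `(m + 1) |t| ≤ π / 2` no frequency wraps around and the product is Gaussian. Beyond that,
-- `|sin t| ≥ 1 / (m + 1)`, so that `m t` and `(m + 1) t` cannot both be close to `π ℤ`.
lemma prod_abs_cos_le_exp_add_exp (hw : ∀ k ∈ s, w k ≤ m + 1)
    (hm : L ≤ (s.filter fun k => w k = m).card)
    (hm' : L ≤ (s.filter fun k => w k = m + 1).card) {t : ℝ} (ht : |t| ≤ π / 2) :
    ∏ k ∈ s, |cos (w k * t)| ≤
      exp (-(2 / π ^ 2 * ∑ k ∈ s, (w k : ℝ) ^ 2) * t ^ 2) +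
        exp (-(L / (4 * (m + 1) ^ 2))) := by
  refine (prod_abs_cos_le_exp_neg_sum_sin_sq_div_two s _).trans ?_
  rcases le_or_gt ((m + 1) * |t|) (π / 2) with hsmall | hlarge
  · refine le_add_of_le_of_nonneg (exp_le_exp.2 ?_) (exp_pos _).le
    have hwt : ∀ k ∈ s, |(w k : ℝ) * t| ≤ π / 2 := fun k hk => by
      rw [abs_mul, Nat.abs_cast]
      refine le_trans ?_ hsmall
      gcongr
      exact_mod_cast hw k hk
    have hsum := four_div_pi_sq_mul_sum_sq_le_sum_sin_sq hwt
    simp only [mul_pow, ← Finset.sum_mul] at hsum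
    calc -((∑ k ∈ s, sin (w k * t) ^ 2) / 2)
        ≤ -(4 / π ^ 2 * ((∑ k ∈ s, (w k : ℝ) ^ 2) * t ^ 2) / 2) := by gcongr
      _ = _ := by ring
  · refine le_add_of_nonneg_of_le (exp_pos _).le (exp_le_exp.2 ?_)
    have hsin : 1 / ((m : ℝ) + 1) ≤ |sin t| := by
      refine le_trans ?_ (mul_abs_le_abs_sin ht)
      rw [div_mul_eq_mul_div, div_le_div_iff₀ (by positivity) pi_pos]
      linarith
    have hsq : 1 / ((m : ℝ) + 1) ^ 2 ≤ sin t ^ 2 := by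
      rw [← sq_abs (sin t), ← one_div_pow]
      gcongr
    have hsum := mul_sin_sq_div_two_le_sum_sin_sq hm hm' t
    rw [neg_le_neg_iff]
    calc L / (4 * ((m : ℝ) + 1) ^ 2) = L * (1 / ((m : ℝ) + 1) ^ 2) / 2 / 2 := by
          field_simp
          norm_num
      _ ≤ L * sin t ^ 2 / 2 / 2 := by gcongr
      _ ≤ _ := by gcongr

lemma intervalIntegral_neg_self_eq_two_mul_of_periodic {f : ℝ → ℝ} {T : ℝ}
    (hf : Function.Periodic f T) (hint : ∀ t₁ t₂, IntervalIntegrable f volume t₁ t₂) :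
    ∫ t in -T..T, f t = 2 * ∫ t in -(T / 2)..T / 2, f t := by
  have hzsmul := hf.intervalIntegral_add_zsmul_eq 2 (-T) hint
  rw [hf.intervalIntegral_add_eq (-T) (-(T / 2)), zsmul_eq_mul, zsmul_eq_mul, Int.cast_ofNat,
    show -T + 2 * T = T by ring, show -(T / 2) + T = T / 2 by ring] at hzsmul
  exact hzsmul

lemma intervalIntegral_exp_neg_mul_sq_le {b x y : ℝ} (hb : 0 < b) (hxy : x ≤ y) :
    ∫ t in x..y, exp (-b * t ^ 2) ≤ √(π / b) := by
  rw [← integral_gaussian, intervalIntegral.integral_of_le hxy]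
  exact setIntegral_le_integral (integrable_exp_neg_mul_sq hb) (.of_forall fun _ => (exp_pos _).le)

lemma concentrationBound_le {a : ℕ → ℕ} {n : ℕ} (ha : ∀ k < n, a (k + 1) ≤ m + 1)
    (hm : L ≤ ((Finset.range n).filter fun k => a (k + 1) = m).card)
    (hm' : L ≤ ((Finset.range n).filter fun k => a (k + 1) = m + 1).card)
    (hpos : 0 < ∑ k ∈ Finset.range n, (a (k + 1) : ℝ) ^ 2) :
    concentrationBound a n ≤ √(π / (2 * ∑ k ∈ Finset.range n, (a (k + 1) : ℝ) ^ 2)) +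
      exp (-(L / (4 * (m + 1) ^ 2))) := by
  set V := ∑ k ∈ Finset.range n, (a (k + 1) : ℝ) ^ 2
  set e := exp (-(L / (4 * ((m : ℝ) + 1) ^ 2)))
  have hpi := pi_pos
  have hper : Function.Periodic (fun t => ∏ k ∈ Finset.range n, |cos (a (k + 1) * t)|) π :=
    fun t => Finset.prod_congr rfl fun k _ => by
      rw [mul_add, cos_add_nat_mul_pi, abs_mul, abs_neg_one_pow, one_mul]
  have hint (f : ℝ → ℝ) (hf : Continuous f) (x y : ℝ) : IntervalIntegrable f volume x y :=
    hf.intervalIntegrable x y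
  calc concentrationBound a n
      = π⁻¹ * ∫ t in -(π / 2)..π / 2, ∏ k ∈ Finset.range n, |cos (a (k + 1) * t)| := by
        rw [concentrationBound, intervalIntegral_neg_self_eq_two_mul_of_periodic hper
          (hint _ (by fun_prop))]
        field_simp
    _ ≤ π⁻¹ * ∫ t in -(π / 2)..π / 2, (exp (-(2 / π ^ 2 * V) * t ^ 2) + e) := by
        gcongr
        refine intervalIntegral.integral_mono_on (by linarith) (hint _ (by fun_prop) _ _)
          (hint _ (by fun_prop) _ _) fun t ht => ?_
        exact prod_abs_cos_le_exp_add_exp (fun k hk => ha k (Finset.mem_range.1 hk)) hm hm'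
          (abs_le.2 ht)
    _ = π⁻¹ * ((∫ t in -(π / 2)..π / 2, exp (-(2 / π ^ 2 * V) * t ^ 2)) + π * e) := by
        rw [intervalIntegral.integral_add (hint _ (by fun_prop) _ _) (hint _ (by fun_prop) _ _),
          intervalIntegral.integral_const, smul_eq_mul, sub_neg_eq_add, add_halves]
    _ ≤ π⁻¹ * (√(π / (2 / π ^ 2 * V)) + π * e) := by
        gcongr
        exact intervalIntegral_exp_neg_mul_sq_le (by positivity) (by linarith)
    _ = √(π / (2 * V)) + e := by
        rw [show π / (2 / π ^ 2 * V) = π ^ 2 * (π / (2 * V)) by field_simp,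
          sqrt_mul (by positivity), sqrt_sq hpi.le]
        field_simp

end ProductsOfCosines

section SlowSteps

variable {l u : ℕ → ℕ}

lemma card_filter_eq_of_galoisConnection (gc : GaloisConnection l u) {i n : ℕ}
    (hn : l (i + 1) ≤ n) : ((Finset.range n).filter fun k => u k = i).card = l (i + 1) - l i := by
  rw [← Nat.card_Ico]
  congr 1
  ext k
  rw [Finset.mem_filter, Finset.mem_range, eq_iff_mem_Ico_of_galoisConnection gc,
    and_iff_right_iff_imp, Finset.mem_Ico]
  omega

lemma sub_mul_sq_le_sum_sq_of_galoisConnection (gc : GaloisConnection l u) (j n : ℕ) :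
    ((n - l j : ℕ) : ℝ) * j ^ 2 ≤ ∑ k ∈ Finset.range n, (u k : ℝ) ^ 2 := by
  calc ((n - l j : ℕ) : ℝ) * j ^ 2 = ∑ k ∈ Finset.Ico (l j) n, (j : ℝ) ^ 2 := by simp
    _ ≤ ∑ k ∈ Finset.Ico (l j) n, (u k : ℝ) ^ 2 := Finset.sum_le_sum fun k hk => by
        have := (gc j k).1 (Finset.mem_Ico.1 hk).1
        gcongr
    _ ≤ ∑ k ∈ Finset.range n, (u k : ℝ) ^ 2 :=
        Finset.sum_le_sum_of_subset_of_nonneg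
          (fun k hk => Finset.mem_range.2 (Finset.mem_Ico.1 hk).2) fun _ _ _ => sq_nonneg _

lemma concentrationBound_le_of_galoisConnection {a c : ℕ → ℕ}
    (gc : GaloisConnection c fun k => a (k + 1)) {m j : ℕ} (hj : 0 < j) (hjm : c j < c (m + 2)) :
    concentrationBound a (c (m + 2)) ≤
      √(Real.pi / (2 * ((c (m + 2) - c j : ℕ) * j ^ 2))) +
        Real.exp (-((min (c (m + 1) - c m) (c (m + 2) - c (m + 1)) : ℕ) / (4 * (m + 1) ^ 2))) := by
  have hpos : (0 : ℝ) < (c (m + 2) - c j : ℕ) * j ^ 2 := by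
    have := Nat.sub_pos_of_lt hjm
    positivity
  have hsum := sub_mul_sq_le_sum_sq_of_galoisConnection gc j (c (m + 2))
  refine (concentrationBound_le (fun k hk => Nat.lt_succ_iff.1 (gc.lt_iff_lt.1 hk)) ?_ ?_
    (hpos.trans_le hsum)).trans (add_le_add_left (Real.sqrt_le_sqrt ?_) _)
  · rw [card_filter_eq_of_galoisConnection gc (gc.monotone_l (Nat.le_succ _))]
    exact min_le_left _ _
  · rw [card_filter_eq_of_galoisConnection gc le_rfl]
    exact min_le_right _ _
  · gcongr

end SlowSteps

section StretchedExponential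

open Real

variable {β : ℝ}

lemma exp_rpow_le_exp_rpow (hβ : 0 ≤ β) {x y : ℝ} (hx : 0 ≤ x) (hxy : x ≤ y) :
    exp (x ^ β) ≤ exp (y ^ β) :=
  exp_le_exp.2 (rpow_le_rpow hx hxy hβ)

lemma div_add_one_le_rpow_add_one_sub_rpow (hβ₀ : 0 ≤ β) (hβ₁ : β ≤ 1) {x : ℝ} (hx : 0 ≤ x) :
    β / (x + 1) ≤ (x + 1) ^ β - x ^ β := by
  have hx1 : 0 < x + 1 := by linarith
  have hbernoulli : (1 + -(1 / (x + 1))) ^ β ≤ 1 + β * -(1 / (x + 1)) :=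
    rpow_one_add_le_one_add_mul_self
      (neg_le_neg ((div_le_one hx1).2 (by linarith))) hβ₀ hβ₁
  have hone : 1 ≤ (x + 1) ^ β := one_le_rpow (by linarith) hβ₀
  rw [le_sub_iff_add_le', ← le_sub_iff_add_le]
  calc x ^ β = (x + 1) ^ β * (1 + -(1 / (x + 1))) ^ β := by
        rw [← mul_rpow hx1.le (by rw [← sub_eq_add_neg, sub_nonneg, div_le_one hx1]; linarith)]
        congr 1
        field_simp
        ring
    _ ≤ (x + 1) ^ β * (1 + β * -(1 / (x + 1))) := by gcongr
    _ = (x + 1) ^ β - (x + 1) ^ β * (β / (x + 1)) := by ring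
    _ ≤ (x + 1) ^ β - β / (x + 1) := by
        gcongr
        exact le_mul_of_one_le_left (by positivity) hone

lemma rpow_add_one_sub_rpow_le (hβ₀ : 0 ≤ β) (hβ₁ : β ≤ 1) {x : ℝ} (hx : 0 < x) :
    (x + 1) ^ β - x ^ β ≤ x ^ (β - 1) := by
  have hinv : 0 < 1 / x := by positivity
  rw [sub_le_iff_le_add']
  calc (x + 1) ^ β = x ^ β * (1 + 1 / x) ^ β := by
        rw [← mul_rpow hx.le (by positivity)]
        congr 1
        field_simp
    _ ≤ x ^ β * (1 + 1 * (1 / x)) := by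
        gcongr
        exact (rpow_one_add_le_one_add_mul_self (by linarith) hβ₀ hβ₁).trans (by gcongr)
    _ = x ^ β + x ^ (β - 1) := by
        rw [rpow_sub_one hx.ne']
        ring

lemma exp_mul_sub_le_exp_sub_exp (x y : ℝ) : exp x * (y - x) ≤ exp y - exp x := by
  have hexp := mul_le_mul_of_nonneg_left (add_one_le_exp (y - x)) (exp_pos x).le
  rw [← exp_add, add_sub_cancel] at hexp
  linarith

lemma exp_rpow_mul_div_le_sub (hβ₀ : 0 ≤ β) (hβ₁ : β ≤ 1) {x : ℝ} (hx : 0 ≤ x) :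
    exp (x ^ β) * (β / (x + 1)) ≤ exp ((x + 1) ^ β) - exp (x ^ β) := by
  refine le_trans ?_ (exp_mul_sub_le_exp_sub_exp _ _)
  gcongr
  exact div_add_one_le_rpow_add_one_sub_rpow hβ₀ hβ₁ hx

lemma exp_rpow_sub_le (hβ₀ : 0 ≤ β) (hβ₁ : β ≤ 1) {x : ℝ} (hx : 0 < x) :
    exp ((x + 1) ^ β) - exp (x ^ β) ≤ exp ((x + 1) ^ β) * x ^ (β - 1) := by
  have hincr := mul_le_mul_of_nonneg_left (rpow_add_one_sub_rpow_le hβ₀ hβ₁ hx)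
    (exp_pos ((x + 1) ^ β)).le
  linarith [exp_mul_sub_le_exp_sub_exp ((x + 1) ^ β) (x ^ β)]

lemma eventually_mul_pow_le_exp_rpow (hβ : 0 < β) (K : ℝ) (p : ℕ) :
    ∀ᶠ x : ℝ in atTop, K * x ^ p ≤ exp (x ^ β) := by
  have htendsto := (tendsto_exp_div_rpow_atTop (p / β)).comp (tendsto_rpow_atTop hβ)
  filter_upwards [htendsto.eventually_ge_atTop K, eventually_gt_atTop 0] with x hx hx0
  rwa [Function.comp_apply, ← rpow_mul hx0.le, mul_div_cancel₀ _ hβ.ne', rpow_natCast,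
    le_div_iff₀ (by positivity)] at hx

lemma eventually_exp_rpow_half_le (hβ : 0 < β) :
    ∀ᶠ x : ℝ in atTop, exp ((x / 2) ^ β) ≤ exp (x ^ β) / 2 := by
  have hc : 0 < 1 - (1 / 2 : ℝ) ^ β :=
    sub_pos.2 (rpow_lt_one (by norm_num) (by norm_num) hβ)
  have htendsto := (tendsto_rpow_atTop hβ).const_mul_atTop hc
  filter_upwards [htendsto.eventually_ge_atTop (log 2), eventually_ge_atTop 0] with x hx hx0
  rw [← exp_log two_pos, ← exp_sub, exp_le_exp, exp_log two_pos, div_eq_mul_one_div,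
    mul_rpow hx0 (by norm_num)]
  linarith

end StretchedExponential

section LogSteps

/-- The step size `⌊(log n) ^ α⌋`, as a natural number. -/
noncomputable def logStep (α : ℝ) (n : ℕ) : ℕ := ⌊Real.log n ^ α⌋₊

/-- For `β = α⁻¹`, the number of steps of the walk with step sizes `logStep α` that are smaller
than `j`. The first `n ≥ 1` with `j ≤ logStep α n` is `⌈exp (j ^ β)⌉₊`, and the step of size
`logStep α (k + 1)` has index `k`, whence the shift by one. -/
noncomputable def blockStart (β : ℝ) (j : ℕ) : ℕ := ⌈Real.exp ((j : ℝ) ^ β)⌉₊ - 1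

lemma galoisConnection_blockStart_logStep {α : ℝ} (hα : 0 < α) :
    GaloisConnection (blockStart α⁻¹) fun k => logStep α (k + 1) := by
  intro j k
  have hlog : 0 ≤ Real.log (k + 1 : ℕ) := Real.log_natCast_nonneg _
  simp only [logStep]
  rw [blockStart, tsub_le_iff_right, Nat.ceil_le,
    ← Real.le_log_iff_exp_le (by positivity),
    Real.rpow_inv_le_iff_of_pos (Nat.cast_nonneg _) hlog hα, Nat.le_floor_iff (by positivity)]

variable {β : ℝ}

lemma blockStart_lt (β : ℝ) (j : ℕ) : (blockStart β j : ℝ) < Real.exp ((j : ℝ) ^ β) := by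
  rw [blockStart, Nat.cast_pred (Nat.ceil_pos.2 (Real.exp_pos _)), sub_lt_iff_lt_add]
  exact Nat.ceil_lt_add_one (Real.exp_pos _).le

lemma sub_one_le_blockStart (β : ℝ) (j : ℕ) :
    Real.exp ((j : ℝ) ^ β) - 1 ≤ blockStart β j := by
  rw [blockStart, Nat.cast_pred (Nat.ceil_pos.2 (Real.exp_pos _))]
  gcongr
  exact Nat.le_ceil _

lemma sub_sub_one_le_blockStart_sub (β : ℝ) (i j : ℕ) :
    Real.exp ((j : ℝ) ^ β) - Real.exp ((i : ℝ) ^ β) - 1 ≤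
      (blockStart β j - blockStart β i : ℕ) := by
  have hsub : (blockStart β j : ℝ) - blockStart β i ≤ (blockStart β j - blockStart β i : ℕ) :=
    sub_le_iff_le_add.2 (mod_cast le_tsub_add)
  linarith [sub_one_le_blockStart β j, blockStart_lt β i]

lemma blockStart_sub_le (hβ : 0 ≤ β) {i j : ℕ} (hij : i ≤ j) :
    ((blockStart β j - blockStart β i : ℕ) : ℝ) ≤
      Real.exp ((j : ℝ) ^ β) - Real.exp ((i : ℝ) ^ β) + 1 := by
  have hmono := exp_rpow_le_exp_rpow hβ (Nat.cast_nonneg i) (Nat.cast_le (α := ℝ).2 hij)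
  rcases le_total (blockStart β j) (blockStart β i) with hle | hle
  · rw [Nat.sub_eq_zero_of_le hle, Nat.cast_zero]
    linarith
  · rw [Nat.cast_sub hle]
    linarith [blockStart_lt β j, sub_one_le_blockStart β i]

lemma exp_rpow_mul_div_sub_one_le_min_blockStart_sub (hβ₀ : 0 ≤ β) (hβ₁ : β ≤ 1) (m : ℕ) :
    Real.exp ((m : ℝ) ^ β) * (β / (m + 2)) - 1 ≤
      (min (blockStart β (m + 1) - blockStart β m)
        (blockStart β (m + 2) - blockStart β (m + 1)) : ℕ) := by
  have hgap {i : ℕ} (hmi : m ≤ i) (him : i ≤ m + 1) : Real.exp ((m : ℝ) ^ β) * (β / (m + 2)) - 1 ≤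
      (blockStart β (i + 1) - blockStart β i : ℕ) := by
    have him' : (i : ℝ) + 1 ≤ m + 2 := by exact_mod_cast Nat.succ_le_succ him
    calc Real.exp ((m : ℝ) ^ β) * (β / (m + 2)) - 1
        ≤ Real.exp ((i : ℝ) ^ β) * (β / (i + 1)) - 1 := by gcongr
      _ ≤ Real.exp (((i : ℝ) + 1) ^ β) - Real.exp ((i : ℝ) ^ β) - 1 := by
          gcongr
          exact exp_rpow_mul_div_le_sub hβ₀ hβ₁ (Nat.cast_nonneg i)
      _ ≤ _ := by exact_mod_cast sub_sub_one_le_blockStart_sub β i (i + 1)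
  rw [Nat.cast_min]
  exact le_min (hgap le_rfl (Nat.le_succ m)) (hgap (Nat.le_succ m) le_rfl)

lemma eventually_exp_neg_div_le (hβ₀ : 0 < β) (hβ₁ : β ≤ 1) :
    ∀ᶠ x : ℝ in atTop,
      Real.exp (-((Real.exp (x ^ β) * (β / (x + 2)) - 1) / (4 * (x + 1) ^ 2))) ≤
        1 / ((x + 1) * √(Real.exp ((x + 2) ^ β))) := by
  filter_upwards [eventually_mul_pow_le_exp_rpow hβ₀ (216 / β) 4, eventually_ge_atTop 1]
    with x hexp hx
  have hpow : (x + 2) ^ β ≤ x + 2 := Real.rpow_le_self_of_one_le (by linarith) hβ₁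
  have hlog : Real.log (x + 1) ≤ x := by
    linarith [Real.log_le_sub_one_of_pos (by linarith : 0 < x + 1)]
  have hmain : 9 * (x + 1) ^ 3 ≤ Real.exp (x ^ β) * (β / (x + 2)) := by
    rw [mul_div_assoc', le_div_iff₀ (by linarith)]
    calc 9 * (x + 1) ^ 3 * (x + 2) ≤ 9 * (2 * x) ^ 3 * (3 * x) := by gcongr <;> linarith
      _ = 216 / β * x ^ 4 * β := by
          field_simp
          ring
      _ ≤ Real.exp (x ^ β) * β := by gcongr
  have hexponent : (Real.log (x + 1) + (x + 2) ^ β / 2) * (4 * (x + 1) ^ 2) ≤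
      Real.exp (x ^ β) * (β / (x + 2)) - 1 := by
    calc (Real.log (x + 1) + (x + 2) ^ β / 2) * (4 * (x + 1) ^ 2)
        ≤ (2 * (x + 1)) * (4 * (x + 1) ^ 2) := by
          gcongr
          linarith
      _ = 9 * (x + 1) ^ 3 - (x + 1) ^ 3 := by ring
      _ ≤ Real.exp (x ^ β) * (β / (x + 2)) - 1 := by
          gcongr
          exact one_le_pow₀ (by linarith)
  calc Real.exp (-((Real.exp (x ^ β) * (β / (x + 2)) - 1) / (4 * (x + 1) ^ 2)))
      ≤ Real.exp (-(Real.log (x + 1) + (x + 2) ^ β / 2)) := by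
        gcongr
        rwa [le_div_iff₀ (by positivity)]
    _ = 1 / ((x + 1) * √(Real.exp ((x + 2) ^ β))) := by
        rw [Real.exp_neg, Real.exp_add, Real.exp_log (by linarith), Real.exp_half, one_div]

lemma sqrt_pi_div_le {x u : ℝ} (hx : 0 < x) (hu : 0 < u) :
    √(Real.pi / (2 * (u * x ^ 2 / 16))) ≤ 6 / (x * √u) := by
  refine Real.sqrt_le_iff.2 ⟨by positivity, ?_⟩
  rw [div_pow, mul_pow, Real.sq_sqrt hu.le, div_le_div_iff₀ (by positivity) (by positivity)]
  calc Real.pi * (x ^ 2 * u) ≤ 4 * (x ^ 2 * u) := by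
        gcongr
        exact Real.pi_lt_four.le
    _ ≤ 6 ^ 2 * (2 * (u * x ^ 2 / 16)) := by nlinarith [mul_pos (pow_pos hx 2) hu]

lemma eventually_exp_mul_sq_le_blockStart_sub_mul_sq (hβ : 0 < β) :
    ∀ᶠ m : ℕ in atTop, Real.exp (((m : ℝ) + 2) ^ β) * (m + 1) ^ 2 / 16 ≤
      (blockStart β (m + 2) - blockStart β ((m + 2) / 2) : ℕ) * (((m + 2) / 2 : ℕ) : ℝ) ^ 2 := by
  have hshift : Tendsto (fun m : ℕ => (m : ℝ) + 2) atTop atTop :=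
    tendsto_atTop_add_const_right atTop 2 tendsto_natCast_atTop_atTop
  filter_upwards [hshift.eventually (eventually_exp_rpow_half_le hβ),
    hshift.eventually (eventually_mul_pow_le_exp_rpow hβ 4 0)] with m hhalf hfour
  have hlower : ((m : ℝ) + 1) / 2 ≤ ((m + 2) / 2 : ℕ) := by
    rw [div_le_iff₀ two_pos]
    exact_mod_cast (by omega : m + 1 ≤ (m + 2) / 2 * 2)
  have hupper : (((m + 2) / 2 : ℕ) : ℝ) ≤ ((m : ℝ) + 2) / 2 := by
    exact_mod_cast Nat.cast_div_le (α := ℝ) (m := m + 2) (n := 2)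
  have hsub := sub_sub_one_le_blockStart_sub β ((m + 2) / 2) (m + 2)
  have hmono := exp_rpow_le_exp_rpow hβ.le (Nat.cast_nonneg _) hupper
  have hquarter : Real.exp (((m : ℝ) + 2) ^ β) / 4 ≤
      (blockStart β (m + 2) - blockStart β ((m + 2) / 2) : ℕ) := by
    push_cast at hsub
    linarith
  calc Real.exp (((m : ℝ) + 2) ^ β) * (m + 1) ^ 2 / 16
      = Real.exp (((m : ℝ) + 2) ^ β) / 4 * (((m : ℝ) + 1) / 2) ^ 2 := by ring
    _ ≤ _ := by gcongr

lemma eventually_concentrationBound_logStep_le {α : ℝ} (hα : 1 ≤ α) :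
    ∀ᶠ m : ℕ in atTop, concentrationBound (logStep α) (blockStart α⁻¹ (m + 2)) ≤
      7 / ((m + 1) * √(Real.exp (((m : ℝ) + 2) ^ α⁻¹))) := by
  have hα₀ : 0 < α := zero_lt_one.trans_le hα
  filter_upwards [eventually_exp_mul_sq_le_blockStart_sub_mul_sq (inv_pos.2 hα₀),
    tendsto_natCast_atTop_atTop.eventually
      (eventually_exp_neg_div_le (inv_pos.2 hα₀) (inv_le_one_of_one_le₀ hα))] with m hsq hexp
  have hgap := exp_rpow_mul_div_sub_one_le_min_blockStart_sub (inv_pos.2 hα₀).le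
    (inv_le_one_of_one_le₀ hα) m
  have hstart : blockStart α⁻¹ ((m + 2) / 2) < blockStart α⁻¹ (m + 2) := by
    by_contra! hle
    rw [Nat.sub_eq_zero_of_le hle, Nat.cast_zero, zero_mul] at hsq
    exact hsq.not_gt (by positivity)
  calc concentrationBound (logStep α) (blockStart α⁻¹ (m + 2))
      ≤ _ := concentrationBound_le_of_galoisConnection (galoisConnection_blockStart_logStep hα₀)
        (by omega) hstart
    _ ≤ √(Real.pi / (2 * (Real.exp (((m : ℝ) + 2) ^ α⁻¹) * (m + 1) ^ 2 / 16))) +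
        Real.exp (-((Real.exp ((m : ℝ) ^ α⁻¹) * (α⁻¹ / (m + 2)) - 1) / (4 * (m + 1) ^ 2))) := by
        gcongr
    _ ≤ 6 / ((m + 1) * √(Real.exp (((m : ℝ) + 2) ^ α⁻¹))) +
        1 / ((m + 1) * √(Real.exp (((m : ℝ) + 2) ^ α⁻¹))) :=
        add_le_add (sqrt_pi_div_le (by positivity) (Real.exp_pos _)) hexp
    _ = 7 / ((m + 1) * √(Real.exp (((m : ℝ) + 2) ^ α⁻¹))) := by ring

lemma eventually_sqrt_blockStart_sub_add_one_le (hβ₀ : 0 < β) (hβ₁ : β ≤ 1) :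
    ∀ᶠ m : ℕ in atTop, √(blockStart β (m + 2) - blockStart β (m + 1) : ℕ) + 1 ≤
      3 * √(Real.exp (((m : ℝ) + 2) ^ β) * (m + 1) ^ (β - 1)) := by
  have hshift : Tendsto (fun m : ℕ => (m : ℝ) + 2) atTop atTop :=
    tendsto_atTop_add_const_right atTop 2 tendsto_natCast_atTop_atTop
  filter_upwards [hshift.eventually (eventually_mul_pow_le_exp_rpow hβ₀ 1 1)] with m hexp
  have hm : (0 : ℝ) < m + 1 := by positivity
  set w := √(Real.exp (((m : ℝ) + 2) ^ β) * (m + 1) ^ (β - 1))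
  have hw : w ^ 2 = Real.exp (((m : ℝ) + 2) ^ β) * (m + 1) ^ (β - 1) :=
    Real.sq_sqrt (by positivity)
  have hone : 1 ≤ w := by
    rw [← one_le_sq_iff₀ (Real.sqrt_nonneg _), hw]
    calc (1 : ℝ) ≤ (m + 1) ^ β := Real.one_le_rpow (by simp) hβ₀.le
      _ = (m + 1) * (m + 1) ^ (β - 1) := by
          rw [Real.rpow_sub_one hm.ne']
          field_simp
      _ ≤ Real.exp (((m : ℝ) + 2) ^ β) * (m + 1) ^ (β - 1) := by
          gcongr
          linarith
  have hsub : ((blockStart β (m + 2) - blockStart β (m + 1) : ℕ) : ℝ) ≤ w ^ 2 + 1 := by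
    have hle := blockStart_sub_le hβ₀.le (Nat.le_add_right (m + 1) 1)
    have hincr := exp_rpow_sub_le hβ₀.le hβ₁ hm
    have htwo : (m : ℝ) + 1 + 1 = m + 2 := by ring
    push_cast at hle
    rw [htwo] at hle hincr
    linarith
  have hsqrt : √(blockStart β (m + 2) - blockStart β (m + 1) : ℕ) ≤ 2 * w :=
    Real.sqrt_le_iff.2 ⟨by positivity, hsub.trans (by nlinarith)⟩
  linarith

lemma summable_sqrt_blockStart_sub_add_one_mul_concentrationBound {α : ℝ} (hα : 1 < α) :
    Summable fun m => (√(blockStart α⁻¹ (m + 1) - blockStart α⁻¹ m : ℕ) + 1) *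
      concentrationBound (logStep α) (blockStart α⁻¹ (m + 1)) := by
  have hβ₀ : 0 < α⁻¹ := by positivity
  have hexponent : (α⁻¹ - 1) / 2 - 1 < -1 := by linarith [inv_lt_one_of_one_lt₀ hα]
  have hmajorant : Summable fun m : ℕ => 21 * ((m : ℝ) + 1) ^ ((α⁻¹ - 1) / 2 - 1) := by
    exact_mod_cast
      ((summable_nat_add_iff 1).2 (Real.summable_nat_rpow.2 hexponent)).mul_left 21
  rw [← summable_nat_add_iff 1]
  refine hmajorant.of_norm_bounded_eventually_nat ?_
  filter_upwards [eventually_concentrationBound_logStep_le hα.le,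
    eventually_sqrt_blockStart_sub_add_one_le hβ₀ (inv_le_one_of_one_le₀ hα.le)] with m hbound hsqrt
  have hm : (0 : ℝ) < m + 1 := by positivity
  have hnonneg := concentrationBound_nonneg (logStep α) (blockStart α⁻¹ (m + 1 + 1))
  rw [Real.norm_of_nonneg (mul_nonneg (by positivity) hnonneg)]
  calc _ ≤ 3 * √(Real.exp (((m : ℝ) + 2) ^ α⁻¹) * (m + 1) ^ (α⁻¹ - 1)) *
        (7 / ((m + 1) * √(Real.exp (((m : ℝ) + 2) ^ α⁻¹)))) := by
        gcongr
    _ = 21 * ((m : ℝ) + 1) ^ ((α⁻¹ - 1) / 2 - 1) := by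
        rw [Real.sqrt_mul (Real.exp_pos _).le, Real.sqrt_eq_rpow (_ ^ (α⁻¹ - 1)),
          ← Real.rpow_mul hm.le, mul_one_div, Real.rpow_sub_one hm.ne' ((α⁻¹ - 1) / 2)]
        field_simp
        norm_num

end LogSteps

theorem corollary1p6_general {Ω : Type*} [MeasurableSpace Ω] (μ : Measure Ω)
    [IsProbabilityMeasure μ] (ε : ℕ → Ω → ℝ) (hε : IsRademacherFamily μ ε) (α : ℝ) (hα : 1 < α) :
    ∀ᵐ ω ∂μ, Tendsto
      (fun n => |rademacherWalk ε (fun n : ℕ => (⌊Real.log (n : ℝ) ^ α⌋ : ℝ)) n ω|)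
      atTop atTop := by
  have hstep : (fun n : ℕ => (⌊Real.log (n : ℝ) ^ α⌋ : ℝ)) = fun n => (logStep α n : ℝ) :=
    funext fun n =>
      (natCast_floor_eq_intCast_floor (Real.rpow_nonneg (Real.log_natCast_nonneg n) α)).symm
  rw [hstep]
  exact hε.ae_tendsto_abs_rademacherWalk (galoisConnection_blockStart_logStep (by positivity))
    (summable_sqrt_blockStart_sub_add_one_mul_concentrationBound hα)

theorem corollary1p6 {Ω : Type*} [MeasurableSpace Ω] (μ : Measure Ω) [IsProbabilityMeasure μ]
    (ε : ℕ → Ω → ℝ) (hε : IsRademacherFamily μ ε) (α : ℝ) (hα : 1 < α) :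
    IsTransient μ (rademacherWalk ε (fun n : ℕ => (⌊Real.log (n : ℝ) ^ α⌋ : ℝ))) :=
  isTransient_of_ae_tendsto_abs (corollary1p6_general μ ε hε α hα)
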